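/- Let $\mathbb F$ be a field and let $M=\bigoplus_{i\ge 1}M_i$ be a graded Lie algebra of maximal class over $\mathbb F$, that is, a Lie algebra graded over the positive integers with $\dim M_1=2$, $\dim M_i\le 1$ for $i\ge 2$, and $[M_i,M_1]=M_{i+1}$ for all $i\ge 1$ ($M$ may be finite-dimensional). For $i\ge 2$ let $C_i=\{a\in M_1: [a,b]=0 \text{ for all } b\in M_i\}$. The first constituent of $M$ is $\{C_2,\dots,C_{\bar q}\}$, and is said to have length $\bar q$, where $\bar q$ is the least index with $C_{\bar q}\ne C_2$, provided such an index exists and $C_{\bar q}\neq M_1$. Any other constituent of $M$ is a set $\{C_{i+1},\dots,C_{i+r}\}$ with $i\ge 2$, $r\ge 1$, $C_i\ne C_2$, $C_{i+1}=\dots=C_{i+r-1}=C_2$ and $C_{i+r}\notin\{C_2,M_1\}$, and has length $r$. Constituents are ordered by the index of their final member. Suppose that the first constituent of $M$ has length $\bar q$, and that $M$ has a second constituent, of length $\bar q-1$. Then $\mathbb F$ has characteristic two, and every constituent of $M$ has length $\bar q$ or $\bar q-1$ except, possibly, for the last one (if there is a last one). Moreover, if there is a last constituent and it is shorter than $\bar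 q-1$, then the penultimate constituent has length $\bar q-1$. -/

import Mathlib

/-- `M = ⨁ 𝒜 i` is a graded Lie algebra of maximal class: the grading is over the positive
integers (encoded by `𝒜 0 = ⊥`), `dim M₁ = 2`, `dim Mᵢ ≤ 1` for `i ≥ 2`, and
`[Mᵢ, M₁] = Mᵢ₊₁` for all `i ≥ 1`. Components may vanish, so `M` may be finite-dimensional. -/
structure IsGradedOfMaximalClass (F : Type*) {M : Type*} [Field F] [LieRing M] [LieAlgebra F M]
    (𝒜 : ℕ → Submodule F M) [GradedLieAlgebra 𝒜] : Prop where
  zero_eq_bot : 𝒜 0 = ⊥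
  rank_one : Module.rank F (𝒜 1) = 2
  rank_le_one : ∀ i, 2 ≤ i → Module.rank F (𝒜 i) ≤ 1
  span_bracket : ∀ i, 1 ≤ i →
    Submodule.span F {z : M | ∃ u ∈ 𝒜 i, ∃ a ∈ 𝒜 1, z = ⁅u, a⁆} = 𝒜 (i + 1)

section Constituents

variable {F M : Type*} [Field F] [LieRing M] [LieAlgebra F M]

/-- The two-step centralizer `Cᵢ = {a ∈ M₁ : [a, b] = 0 for all b ∈ Mᵢ}`. -/
def twoStepCentralizer (𝒜 : ℕ → Submodule F M) (i : ℕ) : Submodule F M where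
  carrier := {a | a ∈ 𝒜 1 ∧ ∀ b ∈ 𝒜 i, ⁅a, b⁆ = 0}
  add_mem' := fun ha hb =>
    ⟨add_mem ha.1 hb.1, fun c hc => by rw [add_lie, ha.2 c hc, hb.2 c hc, add_zero]⟩
  zero_mem' := ⟨zero_mem _, fun c _ => zero_lie c⟩
  smul_mem' := fun t _ ha =>
    ⟨Submodule.smul_mem _ t ha.1, fun c hc => by rw [smul_lie, ha.2 c hc, smul_zero]⟩

/-- The first constituent is `{C₂, …, C_q}`, where `C_q` is the first two-step centralizer with
`q ≥ 2` that is different from `C₂` (which is the line `F y`), and `C_q ≠ M₁`.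
By convention its length is `q`. -/
def IsFirstConstituent (𝒜 : ℕ → Submodule F M) (q : ℕ) : Prop :=
  2 ≤ q ∧ (∀ j, 2 ≤ j → j < q → twoStepCentralizer 𝒜 j = twoStepCentralizer 𝒜 2) ∧
    twoStepCentralizer 𝒜 q ≠ twoStepCentralizer 𝒜 2 ∧ twoStepCentralizer 𝒜 q ≠ 𝒜 1

/-- `{Cᵢ₊₁, …, Cᵢ₊ᵣ}`, with `i ≥ 2`, is a constituent of length `r` (other than the first one):
`Cᵢ ≠ F y`, `Cᵢ₊₁ = ⋯ = Cᵢ₊ᵣ₋₁ = F y`, and `Cᵢ₊ᵣ` is neither `F y` nor `M₁`, where `F y = C₂`. -/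
def IsLaterConstituent (𝒜 : ℕ → Submodule F M) (i r : ℕ) : Prop :=
  2 ≤ i ∧ 1 ≤ r ∧ twoStepCentralizer 𝒜 i ≠ twoStepCentralizer 𝒜 2 ∧
    (∀ j, i < j → j < i + r → twoStepCentralizer 𝒜 j = twoStepCentralizer 𝒜 2) ∧
    twoStepCentralizer 𝒜 (i + r) ≠ twoStepCentralizer 𝒜 2 ∧
    twoStepCentralizer 𝒜 (i + r) ≠ 𝒜 1

/-- `IsConstituent 𝒜 r t`: there is a constituent of length `r` whose final member is `C_t`. -/
inductive IsConstituent (𝒜 : ℕ → Submodule F M) : ℕ → ℕ → Prop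
  | first (q : ℕ) : IsFirstConstituent 𝒜 q → IsConstituent 𝒜 q q
  | later (i r : ℕ) : IsLaterConstituent 𝒜 i r → IsConstituent 𝒜 r (i + r)

/-- The constituent of length `r` ending with `C_t` is the last one. -/
def IsLastConstituent (𝒜 : ℕ → Submodule F M) (r t : ℕ) : Prop :=
  IsConstituent 𝒜 r t ∧ ∀ r' t', IsConstituent 𝒜 r' t' → t' ≤ t

/-- The constituent of length `r` ending with `C_t` is immediately followed, in the sequence of
constituents, by the constituent of length `r'` ending with `C_t'`. -/
def AreConsecutiveConstituents (𝒜 : ℕ → Submodule F M) (r t r' t' : ℕ) : Prop :=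
  IsConstituent 𝒜 r t ∧ IsConstituent 𝒜 r' t' ∧ t < t' ∧
    ∀ r'' t'', IsConstituent 𝒜 r'' t'' → t'' ≤ t ∨ t' ≤ t''

end Constituents

/-! ### Bracket identities for powers of ad x. -/

section AdjointPowers

open LieAlgebra

variable {F M : Type*} [Field F] [LieRing M] [LieAlgebra F M]

/-! Put q = N + 1, take x, y in M₁ with C₂ = Fy and C_q = Fx, and let V_k = (ad x)^k y and W = [y,
V_N]. Since [x, V_N] = 0 and y kills V_l for l < N, the bracket [V_k, V_{N-j}] is (-1)^j binom(k, j)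
(ad x)^{k-j} W. A second constituent of length N keeps (ad x)^{N-1} W nonzero, so antisymmetry of
[V_N, V_{N-j}] forces (-1)^j binom(N, j) = -1 for 1 ≤ j ≤ N. The cases j = 1, 2 give characteristic
two (`two_eq_zero_of_second_length`).

The inner binomials of N + 1 now vanish in F, so (ad x)^{N+1} commutes with ad y. Killing both
generators, it is zero on M; so is (ad y)². Hence later constituents have length between 2 and N +
1.

Suppose one has length R + 1 < N. Since y kills (ad x)^R W = [V_R, V_N], ad y commutes with the
commutator of ad V_R and ad V_N. Evaluate this at the element u₀ where the preceding constituent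
starts. If that constituent has length N + 1, the result contradicts the end of the short one
(`lie_eq_zero_of_prev_long`). If it has length N, the element t following the short constituent is
killed by x (`lie_eq_zero_of_prev_short`) and by y, so M stops there. Strong induction on the
starting index supplies the preceding lengths. -/

theorem ad_pow_succ_apply (x m : M) (j : ℕ) :
    (ad F M x ^ (j + 1)) m = ⁅x, (ad F M x ^ j) m⁆ := by
  rw [pow_succ', Module.End.mul_apply, ad_apply]

theorem ad_pow_lie_comm (x m : M) (j : ℕ) :
    (ad F M x ^ j) ⁅x, m⁆ = ⁅x, (ad F M x ^ j) m⁆ := by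
  rw [← ad_pow_succ_apply, pow_succ, Module.End.mul_apply, ad_apply]

theorem ad_pow_succ_lie (x y m : M) (k : ℕ) :
    ⁅(ad F M x ^ (k + 1)) y, m⁆ =
      ⁅x, ⁅(ad F M x ^ k) y, m⁆⁆ - ⁅(ad F M x ^ k) y, ⁅x, m⁆⁆ := by
  rw [ad_pow_succ_apply, lie_lie]

/-- If `x` kills `u`, then `ad ((ad x)ᵏ y)` acts on `u` as `(ad x)ᵏ (ad y)`. -/
theorem ad_pow_lie_of_lie_eq_zero {x y u : M} (hu : ⁅x, u⁆ = 0) (k : ℕ) :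
    ⁅(ad F M x ^ k) y, u⁆ = (ad F M x ^ k) ⁅y, u⁆ := by
  induction k with
  | zero => simp
  | succ k ih => rw [ad_pow_succ_lie, hu, lie_zero, sub_zero, ih, ad_pow_succ_apply]

/-- If `x` commutes with `v`, then `ad v` commutes with powers of `ad x`. -/
theorem lie_ad_pow_of_lie_eq_zero {x v : M} (hv : ⁅x, v⁆ = 0) (m : M) (k : ℕ) :
    ⁅v, (ad F M x ^ k) m⁆ = (ad F M x ^ k) ⁅v, m⁆ := by
  induction k with
  | zero => simp
  | succ k ih =>
    rw [ad_pow_succ_apply, leibniz_lie, ← lie_skew v x, hv, neg_zero, zero_lie, zero_add, ih,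
      ad_pow_succ_apply]

/-- Brackets of the basis elements `(ad x)ᵏ y` of the first constituent. -/
theorem lie_ad_pow_ad_pow {x y : M} {N : ℕ}
    (hV : ∀ l < N, ⁅y, (ad F M x ^ l) y⁆ = 0) (hN : ⁅x, (ad F M x ^ N) y⁆ = 0)
    (k j : ℕ) (hj : j ≤ N) :
    ⁅(ad F M x ^ k) y, (ad F M x ^ (N - j)) y⁆ =
      ((-1) ^ j * (k.choose j : F)) • (ad F M x ^ (k - j)) ⁅y, (ad F M x ^ N) y⁆ := by
  induction k generalizing j with
  | zero =>
    cases j with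
    | zero => simp
    | succ j => simp [hV (N - (j + 1)) (by omega)]
  | succ k ih =>
    rw [ad_pow_succ_lie, ih j hj]
    cases j with
    | zero =>
      simp only [Nat.sub_zero] at *
      rw [hN, lie_zero, sub_zero, ad_pow_succ_apply]
      simp
    | succ j =>
      rw [← ad_pow_succ_apply, show N - (j + 1) + 1 = N - j by omega, ih j (by omega),
        lie_smul, ← ad_pow_succ_apply, Nat.choose_succ_succ, Nat.add_sub_add_right]
      rcases Nat.lt_or_ge k (j + 1) with h | h
      · rw [Nat.choose_eq_zero_of_lt h]
        simp [pow_succ]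
      · rw [show k - (j + 1) + 1 = k - j by omega, ← sub_smul]
        congr 1
        push_cast
        ring

/-! ### Consequences of the first two constituents: characteristic two and binomials. -/

section FirstConstituent

variable {x y : M} {N : ℕ}

/-- Antisymmetry: [V_N, V_{N-j}] and -[V_{N-j}, V_N] are both multiples of (ad x)^{N-j} W, which is
nonzero because a further power of ad x takes it to (ad x)^{N-1} W. -/
theorem neg_one_pow_mul_choose_eq
    (hV : ∀ l < N, ⁅y, (ad F M x ^ l) y⁆ = 0) (hN : ⁅x, (ad F M x ^ N) y⁆ = 0)
    (hW : (ad F M x ^ (N - 1)) ⁅y, (ad F M x ^ N) y⁆ ≠ 0) (j : ℕ) (hj : 1 ≤ j) (hjN : j ≤ N) :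
    (-1) ^ j * (N.choose j : F) = -1 := by
  have h1 := lie_ad_pow_ad_pow hV hN N j hjN
  have h2 := lie_ad_pow_ad_pow hV hN (N - j) 0 (Nat.zero_le _)
  simp only [pow_zero, Nat.choose_zero_right, Nat.cast_one, mul_one, one_smul, Nat.sub_zero] at h2
  rw [← lie_skew, h2] at h1
  have hne : (ad F M x ^ (N - j)) ⁅y, (ad F M x ^ N) y⁆ ≠ 0 := by
    intro h
    apply hW
    rw [show N - 1 = (j - 1) + (N - j) by omega, pow_add, Module.End.mul_apply, h, map_zero]
  rw [← neg_one_smul F] at h1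
  exact (smul_left_injective F hne h1).symm

/-- The case j = 1 gives N = 1 in F, hence 2 binom(N, 2) = N(N - 1) = 0, while j = 2 gives binom(N,
2) = -1. -/
theorem two_eq_zero_of_second_length (hN2 : 2 ≤ N)
    (hV : ∀ l < N, ⁅y, (ad F M x ^ l) y⁆ = 0) (hN : ⁅x, (ad F M x ^ N) y⁆ = 0)
    (hW : (ad F M x ^ (N - 1)) ⁅y, (ad F M x ^ N) y⁆ ≠ 0) : (2 : F) = 0 := by
  have h1 := neg_one_pow_mul_choose_eq hV hN hW 1 le_rfl (by omega)
  have h2 := neg_one_pow_mul_choose_eq hV hN hW 2 (by omega) hN2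
  have h3 : (N.choose 2 : F) * 2 = N * (N - 1) := by
    have h4 : N.choose 2 * 2 = N * (N - 1) := by
      rw [Nat.choose_two_right, Nat.div_mul_cancel (Nat.even_mul_pred_self N).two_dvd]
    have h5 := congrArg (Nat.cast : ℕ → F) h4
    rw [Nat.cast_mul, Nat.cast_mul, Nat.cast_sub (by omega)] at h5
    simpa using h5
  simp only [Nat.choose_one_right] at h1
  have h4 : (N : F) = 1 := by linear_combination -h1
  rw [h4] at h3
  linear_combination 2 * h2 - h3

theorem choose_eq_one (h2 : (2 : F) = 0)
    (hV : ∀ l < N, ⁅y, (ad F M x ^ l) y⁆ = 0) (hN : ⁅x, (ad F M x ^ N) y⁆ = 0)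
    (hW : (ad F M x ^ (N - 1)) ⁅y, (ad F M x ^ N) y⁆ ≠ 0) (j : ℕ) (hj : j ≤ N) :
    (N.choose j : F) = 1 := by
  rcases Nat.eq_zero_or_pos j with rfl | h
  · simp
  · have h1 := neg_one_pow_mul_choose_eq hV hN hW j h hj
    have h3 : (-1 : F) = 1 := by linear_combination -h2
    rwa [h3, one_pow, one_mul] at h1

theorem choose_succ_eq_zero (h2 : (2 : F) = 0)
    (hV : ∀ l < N, ⁅y, (ad F M x ^ l) y⁆ = 0) (hN : ⁅x, (ad F M x ^ N) y⁆ = 0)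
    (hW : (ad F M x ^ (N - 1)) ⁅y, (ad F M x ^ N) y⁆ ≠ 0) (j : ℕ) (hj : 1 ≤ j) (hjN : j ≤ N) :
    ((N + 1).choose j : F) = 0 := by
  obtain ⟨i, rfl⟩ := Nat.exists_eq_add_of_le' hj
  rw [Nat.choose_succ_succ, Nat.cast_add, choose_eq_one h2 hV hN hW _ (by omega),
    choose_eq_one h2 hV hN hW _ hjN]
  linear_combination h2

/-- In the situation of the first two constituents, `(ad x)^(N+1)` commutes with `ad y`. -/
theorem ad_pow_succ_lie_comm (h2 : (2 : F) = 0)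
    (hV : ∀ l < N, ⁅y, (ad F M x ^ l) y⁆ = 0) (hN : ⁅x, (ad F M x ^ N) y⁆ = 0)
    (hW : (ad F M x ^ (N - 1)) ⁅y, (ad F M x ^ N) y⁆ ≠ 0) (m : M) :
    (ad F M x ^ (N + 1)) ⁅y, m⁆ = ⁅y, (ad F M x ^ (N + 1)) m⁆ := by
  have key := ad_pow_lie (R := F) x y m (N + 1)
  -- In the Leibniz expansion the inner binomials vanish in F, and the term with all N + 1 powers on
  -- y vanishes because [x, V_N] = 0.
  rw [key, Finset.sum_eq_single (0, N + 1)]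
  · simp
  · rintro ⟨a, b⟩ hab hne
    rw [Finset.HasAntidiagonal.mem_antidiagonal] at hab
    simp only at hab
    have ha : a ≠ 0 := by
      rintro rfl
      exact hne (by simp at hab; simp [hab])
    rcases Nat.lt_or_ge N a with h | h
    · have : a = N + 1 := by omega
      subst this
      simp [ad_pow_succ_apply, hN]
    · rw [← Nat.cast_smul_eq_nsmul F, choose_succ_eq_zero h2 hV hN hW a (by omega) h, zero_smul]
  · intro h
    simp at h

end FirstConstituent

/-! ### Brackets inside a later constituent, and pairs of consecutive ones. -/

section Constituent

variable {x y w : M} {R : ℕ}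

theorem neg_eq_self_of_two_eq_zero (h2 : (2 : F) = 0) (m : M) : -m = m := by
  rw [neg_eq_iff_add_eq_zero, ← two_smul F, h2, zero_smul]

theorem lie_ad_pow_eq_zero (hR : ∀ j < R, ⁅y, (ad F M x ^ j) w⁆ = 0) (k j : ℕ) (h : k + j < R) :
    ⁅(ad F M x ^ k) y, (ad F M x ^ j) w⁆ = 0 := by
  induction k generalizing j with
  | zero => simpa using hR j (by omega)
  | succ k ih =>
    rw [ad_pow_succ_lie, ← ad_pow_succ_apply, ih j (by omega), ih (j + 1) (by omega)]
    simp

/-- Each Leibniz step moves one x from y to w; the other term has total exponent below R and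
vanishes, and the sign disappears in characteristic two. -/
theorem lie_ad_pow_eq (h2 : (2 : F) = 0) (hR : ∀ j < R, ⁅y, (ad F M x ^ j) w⁆ = 0) (k j : ℕ)
    (h : k + j = R) :
    ⁅(ad F M x ^ k) y, (ad F M x ^ j) w⁆ = ⁅y, (ad F M x ^ R) w⁆ := by
  induction k generalizing j with
  | zero =>
    obtain rfl : j = R := by omega
    simp
  | succ k ih =>
    rw [ad_pow_succ_lie, ← ad_pow_succ_apply, lie_ad_pow_eq_zero hR k j (by omega),
      ih (j + 1) (by omega), lie_zero, zero_sub, neg_eq_self_of_two_eq_zero h2]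

/-- One exponent beyond R, each of the k Leibniz steps contributes one copy of [x, t], where t = [y,
(ad x)^R w]. -/
theorem lie_ad_pow_eq_smul (h2 : (2 : F) = 0) (hR : ∀ j < R, ⁅y, (ad F M x ^ j) w⁆ = 0)
    (hR' : ⁅y, (ad F M x ^ (R + 1)) w⁆ = 0) (k j : ℕ) (h : k + j = R + 1) :
    ⁅(ad F M x ^ k) y, (ad F M x ^ j) w⁆ = (k : F) • ⁅x, ⁅y, (ad F M x ^ R) w⁆⁆ := by
  induction k generalizing j with
  | zero =>
    obtain rfl : j = R + 1 := by omega
    simpa using hR'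
  | succ k ih =>
    rw [ad_pow_succ_lie, ← ad_pow_succ_apply, lie_ad_pow_eq h2 hR k j (by omega),
      ih (j + 1) (by omega), sub_eq_add_neg, neg_eq_self_of_two_eq_zero h2, Nat.cast_succ,
      add_smul, one_smul, add_comm]

variable {N : ℕ} {u₀ : M}

/-- `ad [(ad x)ᴿ y, (ad x)ᴺ y]` commutes with `ad y` within the second constituent. -/
theorem lie_lie_comm_of_second
    (hV : ∀ l < N, ⁅y, (ad F M x ^ l) y⁆ = 0) (hN : ⁅x, (ad F M x ^ N) y⁆ = 0)
    (hW : ∀ j < N - 1, ⁅y, (ad F M x ^ j) ⁅y, (ad F M x ^ N) y⁆⁆ = 0) (hRN : R < N - 1) (m : M) :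
    ⁅y, ⁅(ad F M x ^ R) y, ⁅(ad F M x ^ N) y, m⁆⁆ - ⁅(ad F M x ^ N) y, ⁅(ad F M x ^ R) y, m⁆⁆⁆ =
      ⁅(ad F M x ^ R) y, ⁅(ad F M x ^ N) y, ⁅y, m⁆⁆⁆ -
        ⁅(ad F M x ^ N) y, ⁅(ad F M x ^ R) y, ⁅y, m⁆⁆⁆ := by
  have h := lie_ad_pow_ad_pow hV hN R 0 (Nat.zero_le _)
  simp only [pow_zero, Nat.choose_zero_right, Nat.cast_one, mul_one, one_smul, Nat.sub_zero] at h
  rw [← lie_lie, ← lie_lie, h, leibniz_lie, hW R hRN, zero_lie, zero_add]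

/-- A constituent of length `N + 1` cannot be followed by one of length less than `N`. -/
theorem lie_eq_zero_of_prev_long (h2 : (2 : F) = 0)
    (hV : ∀ l < N, ⁅y, (ad F M x ^ l) y⁆ = 0) (hN : ⁅x, (ad F M x ^ N) y⁆ = 0)
    (hW : ∀ j < N - 1, ⁅y, (ad F M x ^ j) ⁅y, (ad F M x ^ N) y⁆⁆ = 0) (hRN : R < N - 1)
    (hu₀ : ⁅x, u₀⁆ = 0) (hprev : ∀ j < N, ⁅y, (ad F M x ^ j) ⁅y, u₀⁆⁆ = 0)
    (hu : ⁅x, (ad F M x ^ N) ⁅y, u₀⁆⁆ = 0) (hw : w = ⁅y, (ad F M x ^ N) ⁅y, u₀⁆⁆)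
    (hR : ∀ j < R, ⁅y, (ad F M x ^ j) w⁆ = 0) : ⁅y, (ad F M x ^ R) w⁆ = 0 := by
  have key := lie_lie_comm_of_second hV hN hW hRN u₀
  have e1 : ⁅(ad F M x ^ N) y, ⁅y, u₀⁆⁆ = w := by
    rw [hw, ← lie_ad_pow_eq h2 hprev N 0 (by omega)]
    simp
  have e2 : ⁅(ad F M x ^ R) y, ⁅y, u₀⁆⁆ = 0 := by
    simpa using lie_ad_pow_eq_zero hprev R 0 (by omega)
  have e3 : ⁅(ad F M x ^ R) y, w⁆ = ⁅y, (ad F M x ^ R) w⁆ := by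
    simpa using lie_ad_pow_eq h2 hR R 0 (by omega)
  rw [e1, e2, lie_zero, sub_zero, e3, ad_pow_lie_of_lie_eq_zero hu₀, ad_pow_lie_of_lie_eq_zero hu,
    ← hw, ad_pow_lie_of_lie_eq_zero hu₀, lie_ad_pow_of_lie_eq_zero hN, e1, sub_self,
    lie_zero] at key
  exact key.symm

/-- If a constituent of length `N` is followed by a shorter one, then that is the end of the
algebra. -/
theorem lie_eq_zero_of_prev_short (h2 : (2 : F) = 0) (hNF : (N : F) = 1)
    (hV : ∀ l < N, ⁅y, (ad F M x ^ l) y⁆ = 0) (hN : ⁅x, (ad F M x ^ N) y⁆ = 0)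
    (hW : ∀ j < N - 1, ⁅y, (ad F M x ^ j) ⁅y, (ad F M x ^ N) y⁆⁆ = 0) (hRN : R < N - 1)
    (hu₀ : ⁅x, u₀⁆ = 0) (hprev : ∀ j < N - 1, ⁅y, (ad F M x ^ j) ⁅y, u₀⁆⁆ = 0)
    (hu : ⁅x, (ad F M x ^ (N - 1)) ⁅y, u₀⁆⁆ = 0)
    (hw : w = ⁅y, (ad F M x ^ (N - 1)) ⁅y, u₀⁆⁆)
    (hR : ∀ j < R, ⁅y, (ad F M x ^ j) w⁆ = 0) (hR' : ⁅y, (ad F M x ^ (R + 1)) w⁆ = 0) :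
    ⁅x, ⁅y, (ad F M x ^ R) w⁆⁆ = 0 := by
  have hN1 : N - 1 + 1 = N := by omega
  have key := lie_lie_comm_of_second hV hN hW hRN u₀
  have e0 : (ad F M x ^ N) ⁅y, u₀⁆ = 0 := by rw [← hN1, ad_pow_succ_apply, hu]
  have e1 : ⁅(ad F M x ^ N) y, ⁅y, u₀⁆⁆ = ⁅x, w⁆ := by
    have := lie_ad_pow_eq_smul h2 hprev (by rw [hN1, e0, lie_zero]) N 0 (by omega)
    rw [hNF, one_smul, ← hw] at this
    simpa using this
  have e2 : ⁅(ad F M x ^ R) y, ⁅y, u₀⁆⁆ = 0 := by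
    simpa using lie_ad_pow_eq_zero hprev R 0 (by omega)
  have e3 : ⁅(ad F M x ^ R) y, ⁅x, w⁆⁆ = (R : F) • ⁅x, ⁅y, (ad F M x ^ R) w⁆⁆ := by
    simpa using lie_ad_pow_eq_smul h2 hR hR' R 1 (by omega)
  rw [e1, e2, lie_zero, sub_zero, e3, ad_pow_lie_of_lie_eq_zero hu₀, e0, lie_zero, zero_sub,
    neg_eq_self_of_two_eq_zero h2, ad_pow_lie_of_lie_eq_zero hu₀, lie_ad_pow_of_lie_eq_zero hN,
    e1, ad_pow_lie_comm, ← ad_pow_succ_apply, hR'] at key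
  have e4 := lie_ad_pow_eq_smul h2 hR hR' (R + 1) 0 (by omega)
  rw [pow_zero, Module.End.one_apply] at e4
  -- The relation `key` now says R [x, t] = 0 with t = [y, (ad x)^R w]. Since y commutes with
  -- V_{R+1}, this second relation gives (R + 1) [x, t] = 0, and the two differ by [x, t].
  have e5 : ⁅y, ⁅(ad F M x ^ (R + 1)) y, (ad F M x ^ (N - 1)) ⁅y, u₀⁆⁆⁆ =
      ⁅(ad F M x ^ (R + 1)) y, w⁆ := by
    rw [leibniz_lie, hV _ (by omega), zero_lie, zero_add, hw]
  rw [ad_pow_lie_of_lie_eq_zero hu, ← hw, hR', e4, Nat.cast_succ, add_smul, ← key, zero_add,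
    one_smul] at e5
  exact e5.symm

end Constituent

end AdjointPowers

/-! ### Two-step centralizers and the succession of constituents. -/

section MaximalClass

open LieAlgebra

variable {F M : Type*} [Field F] [LieRing M] [LieAlgebra F M] {𝒜 : ℕ → Submodule F M}

theorem IsConstituent.last_mem {r t : ℕ} (h : IsConstituent 𝒜 r t) :
    2 ≤ t ∧ twoStepCentralizer 𝒜 t ≠ twoStepCentralizer 𝒜 2 ∧
      twoStepCentralizer 𝒜 t ≠ 𝒜 1 := by
  cases h with
  | first q h => exact ⟨h.1, h.2.2⟩
  | later i r h => exact ⟨by have := h.1; omega, h.2.2.2.2⟩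

theorem IsFirstConstituent.le_of_ne {q i : ℕ} (hq : IsFirstConstituent 𝒜 q) (hi : 2 ≤ i)
    (h : twoStepCentralizer 𝒜 i ≠ twoStepCentralizer 𝒜 2) : q ≤ i := by
  by_contra hlt
  exact h (hq.2.1 i hi (by omega))

theorem IsFirstConstituent.three_le {q : ℕ} (hq : IsFirstConstituent 𝒜 q) : 3 ≤ q := by
  have h2 := hq.1
  have : q ≠ 2 := by
    rintro rfl
    exact hq.2.2.1 rfl
  omega

/-- Every index beyond the first constituent whose two-step centralizer is proper and different
from the second one is the end of a later constituent. -/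
theorem IsFirstConstituent.exists_later {q i : ℕ} (hq : IsFirstConstituent 𝒜 q) (hi : q < i)
    (h2 : twoStepCentralizer 𝒜 i ≠ twoStepCentralizer 𝒜 2)
    (h1 : twoStepCentralizer 𝒜 i ≠ 𝒜 1) :
    ∃ j r, IsLaterConstituent 𝒜 j r ∧ i = j + r ∧ q ≤ j := by
  classical
  -- The constituent ending at i starts at the greatest index below i satisfying P; q itself
  -- guarantees that one exists.
  let P : ℕ → Prop := fun j => q ≤ j ∧ twoStepCentralizer 𝒜 j ≠ twoStepCentralizer 𝒜 2
  have hPq : P q := ⟨le_rfl, hq.2.2.1⟩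
  have hspec : P (Nat.findGreatest P (i - 1)) := Nat.findGreatest_spec (by omega) hPq
  have hle : Nat.findGreatest P (i - 1) ≤ i - 1 := Nat.findGreatest_le _
  have hmax : ∀ k, Nat.findGreatest P (i - 1) < k → k ≤ i - 1 → ¬ P k :=
    fun k hk hk' => Nat.findGreatest_is_greatest hk hk'
  revert hspec hle hmax
  generalize Nat.findGreatest P (i - 1) = j
  intro hspec hle hmax
  have hq2 := hq.1
  have hqj := hspec.1
  refine ⟨j, i - j, ⟨by omega, by omega, hspec.2, ?_, ?_, ?_⟩, by omega, hqj⟩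
  · intro k hk hk'
    by_contra hne
    exact hmax k hk (by omega) ⟨by omega, hne⟩
  · rwa [show j + (i - j) = i by omega]
  · rwa [show j + (i - j) = i by omega]

/-- Two later constituents starting at the same place coincide. -/
theorem IsLaterConstituent.length_le {i r r' : ℕ} (h : IsLaterConstituent 𝒜 i r)
    (h' : IsLaterConstituent 𝒜 i r') : r ≤ r' := by
  by_contra hlt
  have := h'.2.1
  exact h'.2.2.2.2.1 (h.2.2.2.1 (i + r') (by omega) (by omega))

/-- A constituent that starts where the constituent of length `r` ends is the next one. -/
theorem IsLaterConstituent.le_or_le {i r r' t' : ℕ} (h : IsLaterConstituent 𝒜 i r)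
    (h' : IsConstituent 𝒜 r' t') : t' ≤ i ∨ i + r ≤ t' := by
  by_contra! hlt
  exact h'.last_mem.2.1 (h.2.2.2.1 t' hlt.1 hlt.2)

theorem twoStepCentralizer_le (i : ℕ) : twoStepCentralizer 𝒜 i ≤ 𝒜 1 := fun _ h => h.1

theorem exists_ne_zero_of_twoStepCentralizer_ne {i : ℕ} (h : twoStepCentralizer 𝒜 i ≠ 𝒜 1) :
    ∃ u ∈ 𝒜 i, u ≠ 0 := by
  by_contra! h0
  refine h (le_antisymm (twoStepCentralizer_le i) fun a ha => ⟨ha, fun u hu => ?_⟩)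
  rw [h0 u hu, lie_zero]

variable [GradedLieAlgebra 𝒜]

theorem ad_pow_mem {x u : M} {i : ℕ} (hx : x ∈ 𝒜 1) (hu : u ∈ 𝒜 i) (j : ℕ) :
    (ad F M x ^ j) u ∈ 𝒜 (i + j) := by
  induction j with
  | zero => simpa using hu
  | succ j ih =>
    rw [ad_pow_succ_apply, show i + (j + 1) = 1 + (i + j) by omega]
    exact SetLike.GradedBracket.bracket_mem hx ih

theorem lie_mem_succ {a u : M} {i : ℕ} (ha : a ∈ 𝒜 1) (hu : u ∈ 𝒜 i) : ⁅a, u⁆ ∈ 𝒜 (i + 1) := by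
  simpa [ad_pow_succ_apply] using ad_pow_mem ha hu 1

namespace IsGradedOfMaximalClass

theorem exists_smul_eq (hM : IsGradedOfMaximalClass F 𝒜) {i : ℕ} (hi : 2 ≤ i) {u v : M}
    (hu : u ∈ 𝒜 i) (hv : v ∈ 𝒜 i)
    (h0 : u ≠ 0) : ∃ c : F, v = c • u := by
  obtain ⟨b, hb⟩ := (rank_submodule_le_one_iff' _).1 (hM.rank_le_one i hi)
  obtain ⟨s, rfl⟩ := Submodule.mem_span_singleton.1 (hb hu)
  obtain ⟨t, rfl⟩ := Submodule.mem_span_singleton.1 (hb hv)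
  have hs : s ≠ 0 := by
    rintro rfl
    simp at h0
  exact ⟨t * s⁻¹, by rw [smul_smul, mul_assoc, inv_mul_cancel₀ hs, mul_one]⟩

theorem exists_pair (hM : IsGradedOfMaximalClass F 𝒜) :
    ∃ a ∈ 𝒜 1, ∃ b ∈ 𝒜 1, a ≠ 0 ∧ ∀ s : F, s • a ≠ b := by
  have h1 : (1 : Cardinal) < Module.rank F (𝒜 1) := by
    rw [hM.rank_one]
    exact_mod_cast Nat.one_lt_two
  have : Nontrivial (𝒜 1) := rank_pos_iff_nontrivial.1 (zero_lt_one.trans h1)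
  obtain ⟨a, ha⟩ := exists_ne (0 : 𝒜 1)
  obtain ⟨b, hb⟩ := exists_linearIndependent_pair_of_one_lt_rank h1 ha
  rw [LinearIndependent.pair_iff' ha] at hb
  refine ⟨a, a.2, b, b.2, by simpa using ha, fun s hs => hb s (Subtype.ext hs)⟩

theorem exists_smul_add_smul_eq (hM : IsGradedOfMaximalClass F 𝒜) {a b c : M} (ha : a ∈ 𝒜 1)
    (hb : b ∈ 𝒜 1) (h0 : a ≠ 0)
    (hab : ∀ s : F, s • a ≠ b) (hc : c ∈ 𝒜 1) : ∃ s t : F, c = s • a + t • b := by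
  have hli : LinearIndependent F ![(⟨a, ha⟩ : 𝒜 1), ⟨b, hb⟩] := by
    rw [LinearIndependent.pair_iff' (by simpa using h0)]
    exact fun s hs => hab s (congrArg Subtype.val hs)
  have hspan := hli.span_eq_top_of_card_eq_finrank
    (by rw [Module.finrank, hM.rank_one]; simp)
  have hmem : (⟨c, hc⟩ : 𝒜 1) ∈ Submodule.span F (Set.range ![(⟨a, ha⟩ : 𝒜 1), ⟨b, hb⟩]) := by
    rw [hspan]
    trivial
  rw [Matrix.range_cons, Matrix.range_cons, Matrix.range_empty, Set.union_empty,
    Set.singleton_union, Submodule.mem_span_pair] at hmem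
  obtain ⟨s, t, h⟩ := hmem
  exact ⟨s, t, (congrArg Subtype.val h).symm⟩

theorem succ_eq_bot (hM : IsGradedOfMaximalClass F 𝒜) {i : ℕ} (hi : 1 ≤ i)
    (h : ∀ u ∈ 𝒜 i, ∀ a ∈ 𝒜 1, ⁅a, u⁆ = 0) :
    𝒜 (i + 1) = ⊥ := by
  rw [← hM.span_bracket i hi, Submodule.span_eq_bot]
  rintro _ ⟨u, hu, a, ha, rfl⟩
  rw [← lie_skew, h u hu a ha, neg_zero]

theorem eq_bot_of_le (hM : IsGradedOfMaximalClass F 𝒜) {m n : ℕ} (hm : 1 ≤ m) (h : 𝒜 m = ⊥)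
    (hmn : m ≤ n) : 𝒜 n = ⊥ := by
  induction n, hmn using Nat.le_induction with
  | base => exact h
  | succ n hn ih =>
    refine hM.succ_eq_bot (by omega) fun u hu a _ => ?_
    rw [ih, Submodule.mem_bot] at hu
    rw [hu, lie_zero]

theorem twoStepCentralizer_eq_iff (hM : IsGradedOfMaximalClass F 𝒜) {i : ℕ} (hi : 1 ≤ i) :
    twoStepCentralizer 𝒜 i = 𝒜 1 ↔ 𝒜 (i + 1) = ⊥ := by
  constructor
  · intro h
    refine hM.succ_eq_bot hi fun u hu a ha => ?_
    rw [← h] at ha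
    exact ha.2 u hu
  · intro h
    refine le_antisymm (twoStepCentralizer_le i) fun a ha => ⟨ha, fun u hu => ?_⟩
    have := lie_mem_succ ha hu
    rwa [h, Submodule.mem_bot] at this

theorem twoStepCentralizer_eq_of_le (hM : IsGradedOfMaximalClass F 𝒜) {i j : ℕ} (hi : 1 ≤ i)
    (hij : i ≤ j)
    (h : twoStepCentralizer 𝒜 i = 𝒜 1) : twoStepCentralizer 𝒜 j = 𝒜 1 := by
  rw [hM.twoStepCentralizer_eq_iff (by omega)] at h ⊢
  exact hM.eq_bot_of_le (by omega) h (by omega)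

/-- Bracketing with a spanning element of M_i maps the plane M₁ to a space of dimension at most one,
so it has a kernel. -/
theorem exists_mem_twoStepCentralizer (hM : IsGradedOfMaximalClass F 𝒜) {i : ℕ} (hi : 2 ≤ i) :
    ∃ a ∈ twoStepCentralizer 𝒜 i, a ≠ 0 := by
  obtain ⟨a, ha, b, hb, h0, hab⟩ := hM.exists_pair
  by_cases haC : a ∈ twoStepCentralizer 𝒜 i
  · exact ⟨a, haC, h0⟩
  obtain ⟨u, hu, hau⟩ : ∃ u ∈ 𝒜 i, ⁅a, u⁆ ≠ 0 := by
    by_contra! h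
    exact haC ⟨ha, h⟩
  obtain ⟨c, hc⟩ := hM.exists_smul_eq (by omega) (lie_mem_succ ha hu) (lie_mem_succ hb hu) hau
  have hu0 : u ≠ 0 := by
    rintro rfl
    simp at hau
  refine ⟨b - c • a, ⟨sub_mem hb (Submodule.smul_mem _ _ ha), fun v hv => ?_⟩, ?_⟩
  · obtain ⟨d, rfl⟩ := hM.exists_smul_eq hi hu hv hu0
    rw [lie_smul, sub_lie, smul_lie, hc, sub_self, smul_zero]
  · exact sub_ne_zero.2 (hab c).symm

/-- A proper subspace of the plane M₁ containing a ≠ 0 is the line Fa. -/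
theorem twoStepCentralizer_le_of_mem (hM : IsGradedOfMaximalClass F 𝒜) {i j : ℕ} {a : M}
    (h0 : a ≠ 0)
    (hai : a ∈ twoStepCentralizer 𝒜 i) (haj : a ∈ twoStepCentralizer 𝒜 j)
    (hi : twoStepCentralizer 𝒜 i ≠ 𝒜 1) :
    twoStepCentralizer 𝒜 i ≤ twoStepCentralizer 𝒜 j := by
  intro c hc
  by_contra hcj
  refine hi (le_antisymm (twoStepCentralizer_le i) fun d hd => ?_)
  obtain ⟨s, t, rfl⟩ := hM.exists_smul_add_smul_eq hai.1 hc.1 h0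
    (fun s hs => hcj (hs ▸ Submodule.smul_mem _ s haj)) hd
  exact add_mem (Submodule.smul_mem _ s hai) (Submodule.smul_mem _ t hc)

theorem twoStepCentralizer_eq_of_mem (hM : IsGradedOfMaximalClass F 𝒜) {i j : ℕ} {a : M}
    (h0 : a ≠ 0)
    (hai : a ∈ twoStepCentralizer 𝒜 i) (haj : a ∈ twoStepCentralizer 𝒜 j)
    (hi : twoStepCentralizer 𝒜 i ≠ 𝒜 1) (hj : twoStepCentralizer 𝒜 j ≠ 𝒜 1) :
    twoStepCentralizer 𝒜 i = twoStepCentralizer 𝒜 j :=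
  le_antisymm (hM.twoStepCentralizer_le_of_mem h0 hai haj hi)
    (hM.twoStepCentralizer_le_of_mem h0 haj hai hj)

theorem twoStepCentralizer_start_ne (hM : IsGradedOfMaximalClass F 𝒜) {i r : ℕ}
    (hi : IsLaterConstituent 𝒜 i r) : twoStepCentralizer 𝒜 i ≠ 𝒜 1 := fun h1 =>
  hi.2.2.2.2.2 (hM.twoStepCentralizer_eq_of_le (by have := hi.1; omega) (by omega) h1)

theorem exists_ne_zero_of_later (hM : IsGradedOfMaximalClass F 𝒜) {i r : ℕ}
    (hi : IsLaterConstituent 𝒜 i r) : ∃ u ∈ 𝒜 i, u ≠ 0 :=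
  exists_ne_zero_of_twoStepCentralizer_ne (hM.twoStepCentralizer_start_ne hi)

/-- If the second constituent has length `r`, then it starts at `q`. -/
theorem isLaterConstituent_of_consecutive (hM : IsGradedOfMaximalClass F 𝒜) {q r t : ℕ}
    (hq : IsFirstConstituent 𝒜 q)
    (h : AreConsecutiveConstituents 𝒜 q q r t) : IsLaterConstituent 𝒜 q r := by
  obtain ⟨-, ht, hqt, hnext⟩ := h
  cases ht with
  | first _ h =>
    have := h.le_of_ne hq.1 hq.2.2.1
    omega
  | later i r h =>
    have hqi := hq.le_of_ne h.1 h.2.2.1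
    have hr := h.2.1
    rcases Nat.eq_or_lt_of_le hqi with rfl | hlt
    · exact h
    · obtain ⟨j, s, hjs, hij, -⟩ :=
        hq.exists_later hlt h.2.2.1 (hM.twoStepCentralizer_start_ne h)
      have := hnext s (j + s) (.later j s hjs)
      omega

end IsGradedOfMaximalClass

end MaximalClass

/-! ### Standard generators, nilpotency of ad x and ad y, bounds on lengths. -/

section Generators

open LieAlgebra

variable {F M : Type*} [Field F] [LieRing M] [LieAlgebra F M]

/-- Generators `x, y` of `M₁` with `C₂ = F y` and `C_q = F x`, where `C_q` ends the first
constituent. -/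
structure AreStandardGenerators (𝒜 : ℕ → Submodule F M) (q : ℕ) (x y : M) : Prop where
  left_mem : x ∈ 𝒜 1
  right_mem : y ∈ 𝒜 1
  exists_eq : ∀ c ∈ 𝒜 1, ∃ s t : F, c = s • x + t • y
  lie_left : ∀ u ∈ 𝒜 q, ⁅x, u⁆ = 0
  lie_right : ∀ i, twoStepCentralizer 𝒜 i = twoStepCentralizer 𝒜 2 → ∀ u ∈ 𝒜 i, ⁅y, u⁆ = 0
  lie_right_ne_zero : ∀ i, 2 ≤ i → twoStepCentralizer 𝒜 i ≠ twoStepCentralizer 𝒜 2 →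
    twoStepCentralizer 𝒜 i ≠ 𝒜 1 → ∀ u ∈ 𝒜 i, u ≠ 0 → ⁅y, u⁆ ≠ 0

variable {𝒜 : ℕ → Submodule F M} [GradedLieAlgebra 𝒜] {q : ℕ} {x y : M}

theorem IsGradedOfMaximalClass.exists_areStandardGenerators
    (hM : IsGradedOfMaximalClass F 𝒜) (hq : IsFirstConstituent 𝒜 q) :
    ∃ x y, AreStandardGenerators 𝒜 q x y := by
  obtain ⟨x, hx, hx0⟩ := hM.exists_mem_twoStepCentralizer hq.1
  obtain ⟨y, hy, hy0⟩ := hM.exists_mem_twoStepCentralizer le_rfl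
  have h2 : twoStepCentralizer 𝒜 2 ≠ 𝒜 1 := fun h =>
    hq.2.2.2 (hM.twoStepCentralizer_eq_of_le (by omega) hq.1 h)
  refine ⟨x, y, hx.1, hy.1, fun c hc => ?_, hx.2, fun i hi u hu => ?_, ?_⟩
  · refine hM.exists_smul_add_smul_eq hx.1 hy.1 hx0 (fun s hs => ?_) hc
    refine hq.2.2.1 (hM.twoStepCentralizer_eq_of_mem hy0 ?_ hy hq.2.2.2 h2)
    exact hs ▸ Submodule.smul_mem _ s hx
  · rw [← hi] at hy
    exact hy.2 u hu
  · intro i hi hi2 hi1 u hu hu0 hyu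
    refine hi2 (hM.twoStepCentralizer_eq_of_mem hy0 ⟨hy.1, fun v hv => ?_⟩ hy hi1 h2)
    obtain ⟨c, rfl⟩ := hM.exists_smul_eq hi hu hv hu0
    rw [lie_smul, hyu, smul_zero]

namespace AreStandardGenerators

theorem succ_eq_bot (h : AreStandardGenerators 𝒜 q x y) (hM : IsGradedOfMaximalClass F 𝒜)
    {i : ℕ} (hi : 2 ≤ i) {u : M} (hu : u ∈ 𝒜 i) (hu0 : u ≠ 0) (hxu : ⁅x, u⁆ = 0)
    (hyu : ⁅y, u⁆ = 0) : 𝒜 (i + 1) = ⊥ := by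
  refine hM.succ_eq_bot (by omega) fun v hv a ha => ?_
  obtain ⟨c, rfl⟩ := hM.exists_smul_eq hi hu hv hu0
  obtain ⟨s, t, rfl⟩ := h.exists_eq a ha
  simp [hxu, hyu]

theorem lie_left_ne_zero (h : AreStandardGenerators 𝒜 q x y) (hM : IsGradedOfMaximalClass F 𝒜)
    {i : ℕ} (hi : 2 ≤ i) (hi2 : twoStepCentralizer 𝒜 i = twoStepCentralizer 𝒜 2)
    (hi1 : twoStepCentralizer 𝒜 i ≠ 𝒜 1) {u : M} (hu : u ∈ 𝒜 i) (hu0 : u ≠ 0) :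
    ⁅x, u⁆ ≠ 0 := fun hxu =>
  hi1 ((hM.twoStepCentralizer_eq_iff (by omega)).2
    (h.succ_eq_bot hM hi hu hu0 hxu (h.lie_right i hi2 u hu)))

/-- A linear map that commutes with `ad x` and `ad y` and kills `x` and `y` vanishes on `M`. -/
theorem map_eq_zero (h : AreStandardGenerators 𝒜 q x y) (hM : IsGradedOfMaximalClass F 𝒜)
    (f : M →ₗ[F] M) (hfx : f x = 0) (hfy : f y = 0) (hx : ∀ m, f ⁅x, m⁆ = ⁅x, f m⁆)
    (hy : ∀ m, f ⁅y, m⁆ = ⁅y, f m⁆) {i : ℕ} (hi : 1 ≤ i) {u : M} (hu : u ∈ 𝒜 i) : f u = 0 := by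
  induction i, hi using Nat.le_induction generalizing u with
  | base =>
    obtain ⟨s, t, rfl⟩ := h.exists_eq u hu
    simp [hfx, hfy]
  | succ i hi ih =>
    rw [← hM.span_bracket i hi] at hu
    refine (Submodule.span_le (p := LinearMap.ker f)).2 ?_ hu
    rintro _ ⟨v, hv, a, ha, rfl⟩
    obtain ⟨s, t, rfl⟩ := h.exists_eq a ha
    rw [SetLike.mem_coe, LinearMap.mem_ker, ← lie_skew, map_neg, add_lie, map_add, smul_lie,
      smul_lie, map_smul, map_smul, hx, hy, ih hv]
    simp

/-- In characteristic two (ad y)² is a derivation. It kills y, and also x because [y, x] has degree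
2 and C₂ contains y. -/
theorem lie_right_lie_right (h : AreStandardGenerators 𝒜 q x y)
    (hM : IsGradedOfMaximalClass F 𝒜) (h2 : (2 : F) = 0) {i : ℕ} (hi : 1 ≤ i) {u : M}
    (hu : u ∈ 𝒜 i) : ⁅y, ⁅y, u⁆⁆ = 0 := by
  have hxy : ⁅y, ⁅y, x⁆⁆ = 0 := h.lie_right 2 rfl _ (lie_mem_succ h.right_mem h.left_mem)
  have hsq := h.map_eq_zero hM (ad F M y ^ 2) (by simpa [pow_two] using hxy) (by simp [pow_two])
    (fun m => ?_) (fun m => by simp [pow_two]) hi hu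
  · simpa [pow_two] using hsq
  · simp only [pow_two, Module.End.mul_apply, ad_apply]
    rw [leibniz_lie y x m, lie_add, leibniz_lie y ⁅y, x⁆, hxy, zero_lie, zero_add,
      leibniz_lie y x, ← add_assoc, ← two_smul F, h2, zero_smul, zero_add]

/-- The shape of a later constituent. -/
theorem lie_ad_pow_of_later (h : AreStandardGenerators 𝒜 q x y)
    (hM : IsGradedOfMaximalClass F 𝒜) {i R : ℕ} (hi : IsLaterConstituent 𝒜 i (R + 1)) {u : M}
    (hu : u ∈ 𝒜 i) (hu0 : u ≠ 0) :
    (∀ j < R, ⁅y, (ad F M x ^ j) ⁅y, u⁆⁆ = 0) ∧ ⁅y, (ad F M x ^ R) ⁅y, u⁆⁆ ≠ 0 := by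
  obtain ⟨h2i, -, hi2, hmid, hend2, hend1⟩ := hi
  have hne : ∀ j ≤ i + (R + 1), 1 ≤ j → twoStepCentralizer 𝒜 j ≠ 𝒜 1 := fun j hj h1j h1 =>
    hend1 (hM.twoStepCentralizer_eq_of_le h1j hj h1)
  have hmem : ∀ j, (ad F M x ^ j) ⁅y, u⁆ ∈ 𝒜 (i + 1 + j) := fun j =>
    ad_pow_mem h.left_mem (lie_mem_succ h.right_mem hu) j
  have hpow : ∀ j ≤ R, (ad F M x ^ j) ⁅y, u⁆ ≠ 0 := by
    intro j
    induction j with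
    | zero =>
      intro _
      simpa using h.lie_right_ne_zero i h2i hi2 (hne i (by omega) (by omega)) u hu hu0
    | succ j ih =>
      intro hj
      rw [ad_pow_succ_apply]
      exact h.lie_left_ne_zero hM (by omega) (hmid (i + 1 + j) (by omega) (by omega))
        (hne _ (by omega) (by omega)) (hmem j) (ih (by omega))
  refine ⟨fun j hj => h.lie_right _ (hmid (i + 1 + j) (by omega) (by omega)) _ (hmem j), ?_⟩
  rw [show i + (R + 1) = i + 1 + R by omega] at hend1 hend2
  exact h.lie_right_ne_zero _ (by omega) hend2 hend1 _ (hmem R) (hpow R le_rfl)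

section FirstTwo

variable {N : ℕ}

theorem ad_pow_mem_first (h : AreStandardGenerators 𝒜 q x y) (l : ℕ) :
    (ad F M x ^ l) y ∈ 𝒜 (l + 1) := by
  rw [add_comm]
  exact ad_pow_mem h.left_mem h.right_mem l

theorem lie_ad_pow_first (h : AreStandardGenerators 𝒜 (N + 1) x y)
    (hq : IsFirstConstituent 𝒜 (N + 1)) : ∀ l < N, ⁅y, (ad F M x ^ l) y⁆ = 0 := by
  intro l hl
  rcases Nat.eq_zero_or_pos l with rfl | hpos
  · simp
  · exact h.lie_right _ (hq.2.1 (l + 1) (by omega) (by omega)) _ (h.ad_pow_mem_first l)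

theorem lie_left_ad_pow_first (h : AreStandardGenerators 𝒜 (N + 1) x y) :
    ⁅x, (ad F M x ^ N) y⁆ = 0 :=
  h.lie_left _ (h.ad_pow_mem_first N)

theorem ad_pow_first_ne_zero (h : AreStandardGenerators 𝒜 (N + 1) x y)
    (hM : IsGradedOfMaximalClass F 𝒜) (hq : IsFirstConstituent 𝒜 (N + 1)) :
    (ad F M x ^ N) y ≠ 0 := by
  have hne : ∀ j ≤ N + 1, 1 ≤ j → twoStepCentralizer 𝒜 j ≠ 𝒜 1 := fun j hj h1j h1 =>
    hq.2.2.2 (hM.twoStepCentralizer_eq_of_le h1j hj h1)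
  have hxy : ⁅x, y⁆ ≠ 0 := by
    intro hxy
    refine hne 1 (by omega) le_rfl ((hM.twoStepCentralizer_eq_iff le_rfl).2
      (hM.succ_eq_bot le_rfl fun u hu a ha => ?_))
    obtain ⟨s, t, rfl⟩ := h.exists_eq u hu
    obtain ⟨s', t', rfl⟩ := h.exists_eq a ha
    have hyx : ⁅y, x⁆ = 0 := by rw [← lie_skew, hxy, neg_zero]
    simp [hxy, hyx]
  have hpow : ∀ l, l + 1 ≤ N → (ad F M x ^ (l + 1)) y ≠ 0 := by
    intro l
    induction l with
    | zero =>
      intro _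
      simpa using hxy
    | succ l ih =>
      intro hl
      rw [ad_pow_succ_apply]
      exact h.lie_left_ne_zero hM (by omega) (hq.2.1 _ (by omega) (by omega))
        (hne _ (by omega) (by omega)) (h.ad_pow_mem_first (l + 1)) (ih (by omega))
  have := hq.three_le
  obtain ⟨K, rfl⟩ : ∃ K, N = K + 1 := ⟨N - 1, by omega⟩
  exact hpow K le_rfl

/-- The shape of the second constituent. -/
theorem lie_ad_pow_second (h : AreStandardGenerators 𝒜 (N + 1) x y)
    (hM : IsGradedOfMaximalClass F 𝒜) (hq : IsFirstConstituent 𝒜 (N + 1))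
    (hs : IsLaterConstituent 𝒜 (N + 1) N) :
    (∀ j < N - 1, ⁅y, (ad F M x ^ j) ⁅y, (ad F M x ^ N) y⁆⁆ = 0) ∧
      (ad F M x ^ (N - 1)) ⁅y, (ad F M x ^ N) y⁆ ≠ 0 := by
  have := hq.three_le
  obtain ⟨K, rfl⟩ : ∃ K, N = K + 1 := ⟨N - 1, by omega⟩
  obtain ⟨h1, h2⟩ := h.lie_ad_pow_of_later hM hs (h.ad_pow_mem_first (K + 1))
    (h.ad_pow_first_ne_zero hM hq)
  refine ⟨h1, fun h0 => h2 ?_⟩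
  rw [Nat.add_sub_cancel] at h0
  rw [h0, lie_zero]

theorem ad_pow_succ_eq_zero (h : AreStandardGenerators 𝒜 (N + 1) x y)
    (hM : IsGradedOfMaximalClass F 𝒜) (hq : IsFirstConstituent 𝒜 (N + 1))
    (hs : IsLaterConstituent 𝒜 (N + 1) N) (h2 : (2 : F) = 0) {i : ℕ} (hi : 1 ≤ i) {u : M}
    (hu : u ∈ 𝒜 i) : (ad F M x ^ (N + 1)) u = 0 := by
  refine h.map_eq_zero hM _ ?_ ?_ (fun m => ad_pow_lie_comm x m _) (fun m => ?_) hi hu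
  · simp [pow_succ]
  · rw [ad_pow_succ_apply, h.lie_left_ad_pow_first]
  · exact ad_pow_succ_lie_comm h2 (h.lie_ad_pow_first hq) h.lie_left_ad_pow_first
      (h.lie_ad_pow_second hM hq hs).2 m

/-- No later constituent has length `1`. -/
theorem two_le_length (h : AreStandardGenerators 𝒜 q x y) (hM : IsGradedOfMaximalClass F 𝒜)
    (h2 : (2 : F) = 0) {i r : ℕ} (hi : IsLaterConstituent 𝒜 i r) : 2 ≤ r := by
  have h1 := hi.2.1
  by_contra hlt
  obtain rfl : r = 0 + 1 := by omega
  obtain ⟨u, hu, hu0⟩ := hM.exists_ne_zero_of_later hi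
  refine (h.lie_ad_pow_of_later hM hi hu hu0).2 ?_
  simpa using h.lie_right_lie_right hM h2 (by have := hi.1; omega) hu

/-- No later constituent is longer than the first one. -/
theorem length_le (h : AreStandardGenerators 𝒜 (N + 1) x y)
    (hM : IsGradedOfMaximalClass F 𝒜) (hq : IsFirstConstituent 𝒜 (N + 1))
    (hs : IsLaterConstituent 𝒜 (N + 1) N) (h2 : (2 : F) = 0) {i r : ℕ}
    (hi : IsLaterConstituent 𝒜 i r) : r ≤ N + 1 := by
  by_contra hlt
  obtain ⟨R, rfl⟩ : ∃ R, r = R + (N + 1) + 1 := ⟨r - (N + 2), by omega⟩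
  obtain ⟨u, hu, hu0⟩ := hM.exists_ne_zero_of_later hi
  refine (h.lie_ad_pow_of_later hM hi hu hu0).2 ?_
  rw [pow_add, Module.End.mul_apply,
    h.ad_pow_succ_eq_zero hM hq hs h2 (by omega) (lie_mem_succ h.right_mem hu), map_zero, lie_zero]

/-- If `R` is `N - 1` or `N`, then `x` kills `(ad x)ᴿ [y, u]` unless it kills the bracket of `y`
with that element. -/
theorem lie_left_ad_pow_eq_zero (h : AreStandardGenerators 𝒜 (N + 1) x y)
    (hM : IsGradedOfMaximalClass F 𝒜) (hq : IsFirstConstituent 𝒜 (N + 1))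
    (hs : IsLaterConstituent 𝒜 (N + 1) N) (h2 : (2 : F) = 0) {i R : ℕ}
    (hR : R = N ∨ R + 1 = N) {u : M} (hu : u ∈ 𝒜 i)
    (hne : ⁅x, ⁅y, (ad F M x ^ R) ⁅y, u⁆⁆⁆ ≠ 0) : ⁅x, (ad F M x ^ R) ⁅y, u⁆⁆ = 0 := by
  by_contra hx
  have hmem : (ad F M x ^ R) ⁅y, u⁆ ∈ 𝒜 (i + 1 + R) :=
    ad_pow_mem h.left_mem (lie_mem_succ h.right_mem hu) R
  obtain ⟨c, hc⟩ := hM.exists_smul_eq (by omega) (lie_mem_succ h.left_mem hmem)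
    (lie_mem_succ h.right_mem hmem) hx
  have hz := h.ad_pow_succ_eq_zero hM hq hs h2 (by omega) (lie_mem_succ h.right_mem hu)
  rcases hR with rfl | rfl
  · rw [ad_pow_succ_apply] at hz
    exact hx hz
  -- For R + 1 = N, put z = (ad x)^R [y, u]. Were [x, z] nonzero, [y, z] would be a multiple of it,
  -- so [x, [y, z]] would be a multiple of (ad x)^{N+1} [y, u] = 0.
  · rw [ad_pow_succ_apply, ad_pow_succ_apply] at hz
    rw [hc, lie_smul, hz, smul_zero] at hne
    exact hne rfl

end FirstTwo

end AreStandardGenerators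

end Generators

/-! ### Induction along the sequence of constituents. -/

section LaterConstituents

open LieAlgebra

variable {F M : Type*} [Field F] [LieRing M] [LieAlgebra F M] {𝒜 : ℕ → Submodule F M}
  [GradedLieAlgebra 𝒜] {N : ℕ} {x y : M}

namespace AreStandardGenerators

theorem lie_left_ne_zero_of_later (h : AreStandardGenerators 𝒜 (N + 1) x y)
    (hM : IsGradedOfMaximalClass F 𝒜) (h2 : (2 : F) = 0) {i r : ℕ}
    (hi : IsLaterConstituent 𝒜 i r) {u : M} (hu : u ∈ 𝒜 i) (hu0 : u ≠ 0) :
    ⁅x, ⁅y, u⁆⁆ ≠ 0 := by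
  have hr := h.two_le_length hM h2 hi
  obtain ⟨R, rfl⟩ : ∃ R, r = R + 1 + 1 := ⟨r - 2, by omega⟩
  intro hx
  refine (h.lie_ad_pow_of_later hM hi hu hu0).2 ?_
  rw [pow_succ, Module.End.mul_apply, ad_apply, hx, map_zero, lie_zero]

/-- Suppose that one of the constituents of length `N` or `N + 1` ends at `i`, and that it is
followed by another constituent. Then `x` kills the component of degree `i`. -/
theorem lie_left_eq_zero_of_later (h : AreStandardGenerators 𝒜 (N + 1) x y)
    (hM : IsGradedOfMaximalClass F 𝒜) (hq : IsFirstConstituent 𝒜 (N + 1))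
    (hs : IsLaterConstituent 𝒜 (N + 1) N) (h2 : (2 : F) = 0) {i r : ℕ}
    (hi : IsLaterConstituent 𝒜 i r)
    (hprev : i = N + 1 ∨ ∃ j s, IsLaterConstituent 𝒜 j s ∧ i = j + s ∧ (s = N + 1 ∨ s = N))
    {u : M} (hu : u ∈ 𝒜 i) : ⁅x, u⁆ = 0 := by
  rcases hprev with rfl | ⟨j, s, hj, rfl, hsN⟩
  · exact h.lie_left u hu
  · have h1s := hj.2.1
    obtain ⟨S, rfl⟩ : ∃ S, s = S + 1 := ⟨s - 1, by omega⟩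
    obtain ⟨u₀, hu₀, hu₀0⟩ := hM.exists_ne_zero_of_later hj
    have hv : (ad F M x ^ S) ⁅y, u₀⁆ ∈ 𝒜 (j + (S + 1)) := by
      rw [show j + (S + 1) = j + 1 + S by omega]
      exact ad_pow_mem h.left_mem (lie_mem_succ h.right_mem hu₀) S
    have hv0 : (ad F M x ^ S) ⁅y, u₀⁆ ≠ 0 := fun h0 =>
      (h.lie_ad_pow_of_later hM hj hu₀ hu₀0).2 (by rw [h0, lie_zero])
    obtain ⟨c, rfl⟩ := hM.exists_smul_eq hi.1 hv hu hv0
    rw [lie_smul, h.lie_left_ad_pow_eq_zero hM hq hs h2 (by omega) hu₀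
      (h.lie_left_ne_zero_of_later hM h2 hi hv hv0), smul_zero]

/-- Later constituents have length `N + 1` or `N`, unless they end the algebra and follow a
constituent of length `N`. -/
theorem length_eq_or_ends (h : AreStandardGenerators 𝒜 (N + 1) x y)
    (hM : IsGradedOfMaximalClass F 𝒜) (hq : IsFirstConstituent 𝒜 (N + 1))
    (hs : IsLaterConstituent 𝒜 (N + 1) N) (h2 : (2 : F) = 0) (i r : ℕ)
    (hi : IsLaterConstituent 𝒜 i r) :
    (r = N + 1 ∨ r = N) ∨ (twoStepCentralizer 𝒜 (i + r + 1) = 𝒜 1 ∧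
      ∃ j, IsLaterConstituent 𝒜 j N ∧ i = j + N) := by
  induction i using Nat.strong_induction_on generalizing r with
  | _ i ih =>
  -- The bound k ≤ i allows use both at i and at the start of the preceding constituent. A
  -- predecessor that ends the algebra is impossible, since a constituent follows it.
  have hprev : ∀ k ≤ i, ∀ t, IsLaterConstituent 𝒜 k t →
      k = N + 1 ∨ ∃ j s, IsLaterConstituent 𝒜 j s ∧ k = j + s ∧ (s = N + 1 ∨ s = N) := by
    intro k hk t hkt
    rcases Nat.eq_or_lt_of_le (hq.le_of_ne hkt.1 hkt.2.2.1) with heq | hlt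
    · exact Or.inl heq.symm
    · obtain ⟨j, s, hjs, rfl, -⟩ :=
        hq.exists_later hlt hkt.2.2.1 (hM.twoStepCentralizer_start_ne hkt)
      have hs1 := hjs.2.1
      have ht1 := hkt.2.1
      rcases ih j (by omega) s hjs with hN | ⟨hend, -⟩
      · exact Or.inr ⟨j, s, hjs, rfl, hN⟩
      · exact absurd (hM.twoStepCentralizer_eq_of_le (by omega) (by omega) hend) hkt.2.2.2.2.2
  have hle := h.length_le hM hq hs h2 hi
  have hge := h.two_le_length hM h2 hi
  have hN3 := hq.three_le
  by_cases hrN : N ≤ r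
  · omega
  right
  obtain ⟨R, rfl⟩ : ∃ R, r = R + 1 := ⟨r - 1, by omega⟩
  have hV := h.lie_ad_pow_first hq
  have hVN := h.lie_left_ad_pow_first
  obtain ⟨hW, hW0⟩ := h.lie_ad_pow_second hM hq hs
  rcases hprev i le_rfl _ hi with rfl | ⟨j, s, hj, hij, hsN⟩
  · have := hs.length_le hi
    omega
  have hs1 := hj.2.1
  obtain ⟨S, rfl⟩ : ∃ S, s = S + 1 := ⟨s - 1, by omega⟩
  obtain ⟨u₀, hu₀, hu₀0⟩ := hM.exists_ne_zero_of_later hj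
  have hxu₀ := h.lie_left_eq_zero_of_later hM hq hs h2 hj (hprev j (by omega) _ hj) hu₀
  obtain ⟨hmid, hend⟩ := h.lie_ad_pow_of_later hM hj hu₀ hu₀0
  have hu : (ad F M x ^ S) ⁅y, u₀⁆ ∈ 𝒜 i := by
    rw [hij, show j + (S + 1) = j + 1 + S by omega]
    exact ad_pow_mem h.left_mem (lie_mem_succ h.right_mem hu₀) S
  have hu0 : (ad F M x ^ S) ⁅y, u₀⁆ ≠ 0 := fun h0 => hend (by rw [h0, lie_zero])
  have hxu := h.lie_left_eq_zero_of_later hM hq hs h2 hi (hprev i le_rfl _ hi) hu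
  obtain ⟨hR, ht⟩ := h.lie_ad_pow_of_later hM hi hu hu0
  rcases hsN with hSN | rfl
  · obtain rfl : S = N := by omega
    exact absurd (lie_eq_zero_of_prev_long h2 hV hVN hW (by omega) hxu₀ hmid hxu rfl hR) ht
  · have hz : (ad F M x ^ R) ⁅y, (ad F M x ^ S) ⁅y, u₀⁆⁆ ∈ 𝒜 (i + 1 + R) :=
      ad_pow_mem h.left_mem (lie_mem_succ h.right_mem hu) R
    have hyt := h.lie_right_lie_right hM h2 (by omega) hz
    have htmem := lie_mem_succ h.right_mem hz
    -- With z = (ad x)^R [y, (ad x)^S [y, u₀]], the element [x, z] is a multiple of [y, z] ≠ 0,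
    -- which (ad y)² = 0 makes y kill.
    have hR' : ⁅y, (ad F M x ^ (R + 1)) ⁅y, (ad F M x ^ S) ⁅y, u₀⁆⁆⁆ = 0 := by
      obtain ⟨c, hc⟩ := hM.exists_smul_eq (by omega) htmem (lie_mem_succ h.left_mem hz) ht
      rw [ad_pow_succ_apply, hc, lie_smul, hyt, smul_zero]
    have hNF : ((S + 1 : ℕ) : F) = 1 := by
      simpa using choose_eq_one h2 hV hVN hW0 1 (by omega)
    have hxt := lie_eq_zero_of_prev_short h2 hNF hV hVN hW (by omega) hxu₀ hmid hxu rfl hR hR'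
    refine ⟨?_, j, hj, hij⟩
    rw [hM.twoStepCentralizer_eq_iff (by omega)]
    have := h.succ_eq_bot hM (by omega) htmem ht hxt hyt
    rwa [show i + (R + 1) + 1 + 1 = i + 1 + R + 1 + 1 by omega]

end AreStandardGenerators

end LaterConstituents

theorem proposition4p2 {F M : Type*} [Field F] [LieRing M] [LieAlgebra F M]
    (𝒜 : ℕ → Submodule F M) [GradedLieAlgebra 𝒜] (hM : IsGradedOfMaximalClass F 𝒜)
    (q t₂ : ℕ) (hfirst : IsFirstConstituent 𝒜 q)
    (hsecond : AreConsecutiveConstituents 𝒜 q q (q - 1) t₂) :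
    CharP F 2 ∧
    (∀ r t, IsConstituent 𝒜 r t → ¬ IsLastConstituent 𝒜 r t → r = q ∨ r = q - 1) ∧
    (∀ r t, IsLastConstituent 𝒜 r t → r < q - 1 →
      ∃ t', AreConsecutiveConstituents 𝒜 (q - 1) t' r t) := by
  have hs := hM.isLaterConstituent_of_consecutive hfirst hsecond
  have hq3 := hfirst.three_le
  obtain ⟨N, rfl⟩ : ∃ N, q = N + 1 := ⟨q - 1, by omega⟩
  rw [Nat.add_sub_cancel] at *
  obtain ⟨x, y, h⟩ := hM.exists_areStandardGenerators hfirst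
  have h2 : (2 : F) = 0 := two_eq_zero_of_second_length (by omega) (h.lie_ad_pow_first hfirst)
    h.lie_left_ad_pow_first (h.lie_ad_pow_second hM hfirst hs).2
  have key := h.length_eq_or_ends hM hfirst hs h2
  have first_length : ∀ r, IsFirstConstituent 𝒜 r → r = N + 1 := fun r hr =>
    le_antisymm (hr.le_of_ne hfirst.1 hfirst.2.2.1) (hfirst.le_of_ne hr.1 hr.2.2.1)
  refine ⟨CharTwo.of_one_ne_zero_of_two_eq_zero one_ne_zero h2, fun r t hrt hlast => ?_,
    fun r t hlast hr => ?_⟩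
  · cases hrt with
    | first _ hr => exact Or.inl (first_length _ hr)
    | later i r hi =>
      rcases key i r hi with hr | ⟨hend, -⟩
      · exact hr
      -- From index i + r + 1 on every two-step centralizer is M₁, so no constituent ends later.
      · refine absurd ⟨.later i r hi, fun r' t' h' => ?_⟩ hlast
        by_contra hlt
        exact h'.last_mem.2.2 (hM.twoStepCentralizer_eq_of_le (by omega) (by omega) hend)
  · obtain ⟨hrt, -⟩ := hlast
    cases hrt with
    | first _ hr' =>
      have := first_length _ hr'
      omega
    | later i r hi =>
      rcases key i r hi with hr' | ⟨-, j, hj, rfl⟩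
      · omega
      · have hr1 := hi.2.1
        exact ⟨j + N, .later j N hj, .later (j + N) r hi, by omega,
          fun r'' t'' h'' => hi.le_or_le h''⟩
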